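/- Let $R>0$, $R_D>0$ and $\lambda\ge 0$. Suppose that the transmitters (the potential D2D users) form a Poisson point process of constant density $\lambda$ on the disk of radius $R$ centred at the origin of the plane, with no transmitters outside this disk. Suppose that each transmitter has one receiver and that, given the transmitters, the receivers are independent, each uniformly distributed in the disk of radius $R_D$ centred at its transmitter. Then the locations of the receivers form a Poisson point process on the plane whose intensity measure has, with respect to Lebesgue measure, the density $\lambda^{\mathrm{DRx}}(d)$ at points at distance $d\ge 0$ from the origin, where $$\lambda^{\mathrm{DRx}}(d)=\begin{cases}\lambda, & 0\le d<R-R_D,\\[2pt] \lambda\,\dfrac{\psi(d,R,R_D)}{\pi R_D^2}, & d\ge 0,\ R-R_D\le d\le R+R_D,\\[2pt] 0, & d>R+R_D,\end{cases}$$ and $\psi(d,r_1,r_2)$ is the area of the overlap of two disks of radii $r_1,r_2$ whose centres are at distance $d$. Moreover, for all $d>0$ with $|R-R_D|\le d\le R+R_D$, this area is, with $r_1=R$ and $r_2=R_D$, $$\psi(d,r_1,r_2)=r_1^2\arccos\frac{d^2+r_1^2-r_2^2}{2dr_1}+r_2^2\arccos\frac{d^2+r_2^2-r_1^2}{2dr_2}-\frac12\sqrt{2r_2^2(r_1^2+d^2)-r_2^4-(r_1^2-d^2)^2}.$$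 -/

import Mathlib

open MeasureTheory

/-- The Euclidean plane. -/
abbrev Plane : Type := EuclideanSpace ℝ (Fin 2)

/-- The counting measure of the (random, finite) list of points `x 0 ω, …, x (N ω - 1) ω`,
counted with multiplicity. -/
noncomputable def pointMeasure {Ω : Type*} (N : Ω → ℕ) (x : ℕ → Ω → Plane) (ω : Ω) :
    Measure Plane :=
  ∑ k ∈ Finset.range (N ω), Measure.dirac (x k ω)

/-- The random measure `Φ` on the plane is a Poisson point process with intensity measure `Λ`. -/
structure IsPoissonPointProcess {Ω : Type*} [MeasurableSpace Ω] (P : Measure Ω)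
    (Φ : Ω → Measure Plane) (Λ : Measure Plane) : Prop where
  /-- `Φ` is a random measure. -/
  measurable : Measurable Φ
  /-- Almost surely `Φ` is the counting measure of countably many points. -/
  counting : ∀ᵐ ω ∂P, ∃ (S : Set ℕ) (z : ℕ → Plane),
    Φ ω = Measure.sum (fun i : S => Measure.dirac (z i))
  /-- Almost surely the points do not accumulate. -/
  locallyFinite : ∀ᵐ ω ∂P, IsLocallyFiniteMeasure (Φ ω)
  /-- The number of points in a set of finite intensity is Poisson distributed. -/
  poisson : ∀ A : Set Plane, MeasurableSet A → Λ A ≠ ⊤ →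
    P.map (fun ω => Φ ω A) =
      (ProbabilityTheory.poissonMeasure (Λ A).toNNReal).map (fun n : ℕ => (n : ENNReal))
  /-- The numbers of points in pairwise disjoint sets are independent. -/
  indep : ∀ (n : ℕ) (A : Fin n → Set Plane), (∀ i, MeasurableSet (A i)) →
    (∀ i j, i ≠ j → Disjoint (A i) (A j)) →
    ProbabilityTheory.iIndepFun (fun i ω => Φ ω (A i)) P

/-- The uniform distribution on the disk of radius `r` centred at `c`. -/
noncomputable def uniformDisk (c : Plane) (r : ℝ) : Measure Plane :=
  ProbabilityTheory.cond volume (Metric.closedBall c r)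

/-- Conditionally on the number `N` of transmitters and on their locations `x 0, …, x (N - 1)`,
the receivers `y 0, …, y (N - 1)` are independent, and `y k` is uniformly distributed in the disk
of radius `r` centred at `x k`. -/
def HasUniformReceivers {Ω : Type*} [MeasurableSpace Ω] (P : Measure Ω)
    (N : Ω → ℕ) (x y : ℕ → Ω → Plane) (r : ℝ) : Prop :=
  ∀ (n : ℕ) (A : Set (Fin n → Plane)) (B : Fin n → Set Plane),
    MeasurableSet A → (∀ i, MeasurableSet (B i)) →
    P {ω | N ω = n ∧ (fun i : Fin n => x i ω) ∈ A ∧ ∀ i : Fin n, y i ω ∈ B i} =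
      ∫⁻ ω in {ω | N ω = n ∧ (fun i : Fin n => x i ω) ∈ A},
        ∏ i : Fin n, uniformDisk (x i ω) r (B i) ∂P

/-- The area of the overlap of two disks of radii `r₁`, `r₂` with centres at distance `d`. -/
noncomputable def overlapArea (d r₁ r₂ : ℝ) : ℝ :=
  volume.real (Metric.closedBall (0 : Plane) r₁ ∩ Metric.closedBall (!₂[d, 0] : Plane) r₂)

/-- The closed form for the area of the lens in which two disks overlap. -/
noncomputable def lensFormula (d r₁ r₂ : ℝ) : ℝ :=
  r₁ ^ 2 * Real.arccos ((d ^ 2 + r₁ ^ 2 - r₂ ^ 2) / (2 * d * r₁))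
    + r₂ ^ 2 * Real.arccos ((d ^ 2 + r₂ ^ 2 - r₁ ^ 2) / (2 * d * r₂))
    - Real.sqrt (2 * r₂ ^ 2 * (r₁ ^ 2 + d ^ 2) - r₂ ^ 4 - (r₁ ^ 2 - d ^ 2) ^ 2) / 2

/-- The density of the receivers at distance `d` from the centre of the network region. -/
noncomputable def receiverDensity (lam R RD d : ℝ) : ℝ :=
  if d < R - RD then lam
  else if d ≤ R + RD then lam * (overlapArea d R RD / (Real.pi * RD ^ 2))
  else 0

/-!
The receivers are the transmitters displaced independently, each by the kernel
`uniformDiskKernel`, so the first claim is an instance of the displacement theorem for Poisson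
processes of finite intensity (`IsPoissonPointProcess.displacement`).

That theorem is proved with generating functionals. For a Poisson process with points
`x 0, …, x (N - 1)` and intensity `Λ`,
`E ∏ k < N, g (x k) = exp (∫ (g - 1) ∂Λ)` whenever `g` is a complex function with `‖g‖ ≤ 1`
(`IsPoissonPointProcess.integral_prod`). The formula holds for every numbering of the points, which
is why nothing about the joint law of the `x k` is needed. Given the transmitters, the conditional
expectation of `∏ k, g (y k)` is `∏ k, ∫ g ∂κ (x k)` (`integral_prod_displaced`), so the
functional of the displaced points is again of Poisson form, with intensity `Λ.bind κ`. Evaluated at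
exponentials of step functions it is the joint characteristic function of the counts of disjoint
sets, and this identifies the counts as independent Poisson variables
(`isPoissonPointProcess_of_integral_prod`).

By Fubini's theorem the intensity `Λ.bind κ` has at `z` the density
`λ / (π R_D ^ 2)` times the area of the overlap of the disk of radius `R_D` about `z` with the
network region (`bind_uniformDiskKernel`). That area is computed by cutting the lens along the
common chord of the two circles into a segment of each disk, and integrating over vertical slices
(`volume_disk_segment`, `overlapArea_eq_lensFormula`).
-/

/-! ### Counting the points of a finite configuration -/

/-- The number of points in `A` among `x 0 ω, …, x (N ω - 1) ω`, counted with multiplicity. -/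
noncomputable def pointCount {Ω : Type*} (N : Ω → ℕ) (x : ℕ → Ω → Plane) (A : Set Plane)
    (ω : Ω) : ℕ :=
  ∑ k ∈ Finset.range (N ω), A.indicator 1 (x k ω)

lemma Measurable.comp_nat_index {Ω β : Type*} [MeasurableSpace Ω] [MeasurableSpace β] {N : Ω → ℕ}
    (hN : Measurable N) {F : ℕ → Ω → β} (hF : ∀ n, Measurable (F n)) :
    Measurable fun ω => F (N ω) ω := by
  have h : Measurable fun p : ℕ × Ω => F p.1 p.2 :=
    measurable_from_prod_countable_right fun n => hF n
  exact h.comp (hN.prodMk measurable_id)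

lemma pointMeasure_apply {Ω : Type*} (N : Ω → ℕ) (x : ℕ → Ω → Plane) {A : Set Plane}
    (hA : MeasurableSet A) (ω : Ω) : pointMeasure N x ω A = (pointCount N x A ω : ENNReal) := by
  classical
  simp only [pointMeasure, pointCount, Measure.finsetSum_apply, Nat.cast_sum]
  refine Finset.sum_congr rfl fun k _ => ?_
  rw [Measure.dirac_apply' _ hA]
  by_cases h : x k ω ∈ A <;> simp [h]

lemma measurable_pointCount {Ω : Type*} [MeasurableSpace Ω] {N : Ω → ℕ} {x : ℕ → Ω → Plane}
    (hN : Measurable N) (hx : ∀ k, Measurable (x k)) {A : Set Plane} (hA : MeasurableSet A) :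
    Measurable (pointCount N x A) :=
  hN.comp_nat_index fun _ => Finset.measurable_fun_sum _ fun k _ =>
    (measurable_one.indicator hA).comp (hx k)

lemma measurable_pointMeasure {Ω : Type*} [MeasurableSpace Ω] {N : Ω → ℕ} {x : ℕ → Ω → Plane}
    (hN : Measurable N) (hx : ∀ k, Measurable (x k)) : Measurable (pointMeasure N x) := by
  refine Measure.measurable_of_measurable_coe _ fun A hA => ?_
  simp_rw [pointMeasure_apply N x hA]
  exact (measurable_from_top (f := fun n : ℕ => (n : ENNReal))).comp
    (measurable_pointCount hN hx hA)

lemma measurable_prod_points {Ω : Type*} [MeasurableSpace Ω] {N : Ω → ℕ} {x : ℕ → Ω → Plane}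
    (hN : Measurable N) (hx : ∀ k, Measurable (x k)) {g : Plane → ℂ} (hg : Measurable g) :
    Measurable fun ω => ∏ k ∈ Finset.range (N ω), g (x k ω) :=
  hN.comp_nat_index (F := fun n ω => ∏ k ∈ Finset.range n, g (x k ω)) fun _ =>
    Finset.measurable_fun_prod _ fun k _ => hg.comp (hx k)

lemma norm_prod_points_le_one (s : Finset ℕ) (z : ℕ → Plane) {g : Plane → ℂ}
    (hg : ∀ z, ‖g z‖ ≤ 1) : ‖∏ k ∈ s, g (z k)‖ ≤ 1 := by
  rw [norm_prod]
  exact Finset.prod_le_one (fun _ _ => norm_nonneg _) fun k _ => hg _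

/-- For simple `g` the product over the points depends only on how many points lie in each level
set of `g`, so its law is determined by the counts and not by the numbering of the points. -/
lemma prod_points_eq_prod_pow {Ω : Type*} (N : Ω → ℕ) (x : ℕ → Ω → Plane)
    (g : SimpleFunc Plane ℂ) (ω : Ω) :
    ∏ k ∈ Finset.range (N ω), g (x k ω) =
      ∏ c : g.range, (c : ℂ) ^ pointCount N x (g ⁻¹' {(c : ℂ)}) ω := by
  classical
  simp only [pointCount, ← Finset.prod_pow_eq_pow_sum]
  rw [Finset.prod_comm]
  refine Finset.prod_congr rfl fun k _ => ?_
  rw [Finset.prod_eq_single (⟨g (x k ω), SimpleFunc.mem_range_self _ _⟩ : g.range)]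
  · simp
  · intro c _ hc
    have : x k ω ∉ g ⁻¹' {(c : ℂ)} := fun h => hc (Subtype.ext (by simpa using h.symm))
    simp [Set.indicator_of_notMem this]
  · simp

/-! ### The generating functional of a Poisson process -/

/-- The probability generating function of the Poisson distribution. -/
lemma integral_pow_poissonMeasure (r : NNReal) (c : ℂ) :
    ∫ n : ℕ, c ^ n ∂(ProbabilityTheory.poissonMeasure r) = Complex.exp (r * (c - 1)) := by
  rw [ProbabilityTheory.integral_poissonMeasure]
  calc ∑' n : ℕ, (Real.exp (-r) * r ^ n / n.factorial : ℝ) • c ^ n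
      = ∑' n : ℕ, Complex.exp (-r) * ((r * c) ^ n / n.factorial) := by
        congr with n
        rw [Complex.real_smul]
        push_cast
        ring
    _ = Complex.exp (r * (c - 1)) := by
        rw [tsum_mul_left, (NormedSpace.expSeries_div_hasSum_exp ((r : ℂ) * c)).tsum_eq,
          ← Complex.exp_eq_exp_ℂ, ← Complex.exp_add]
        ring_nf

lemma SimpleFunc.comp_eq_sum_indicator (g : SimpleFunc Plane ℂ) (h : ℂ → ℂ) (z : Plane) :
    h (g z) = ∑ c : g.range, (g ⁻¹' {(c : ℂ)}).indicator (fun _ => h c) z := by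
  rw [Finset.sum_eq_single (⟨g z, SimpleFunc.mem_range_self _ _⟩ : g.range)]
  · simp
  · intro c _ hc
    have : z ∉ g ⁻¹' {(c : ℂ)} := fun h => hc (Subtype.ext (by simpa using h.symm))
    rw [Set.indicator_of_notMem this]
  · simp

lemma integral_comp_simpleFunc (Λ : Measure Plane) [IsFiniteMeasure Λ]
    (g : SimpleFunc Plane ℂ) (h : ℂ → ℂ) :
    ∫ z, h (g z) ∂Λ = ∑ c : g.range, Λ.real (g ⁻¹' {(c : ℂ)}) * h c := by
  simp_rw [SimpleFunc.comp_eq_sum_indicator g h]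
  rw [integral_finsetSum _ fun c _ =>
    (integrable_const _).indicator (SimpleFunc.measurableSet_preimage _ _)]
  refine Finset.sum_congr rfl fun c _ => ?_
  rw [integral_indicator_const _ (SimpleFunc.measurableSet_preimage _ _), Complex.real_smul]

/-- The generating functional of a Poisson point process at a simple function: the factors
`c ^ Φ(g = c)` are independent, and each is the generating function of a Poisson variable. -/
lemma IsPoissonPointProcess.integral_prod_simpleFunc {Ω : Type*} [MeasurableSpace Ω]
    {P : Measure Ω} {N : Ω → ℕ} {x : ℕ → Ω → Plane} {Λ : Measure Plane} [IsFiniteMeasure Λ]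
    (hΦ : IsPoissonPointProcess P (pointMeasure N x) Λ) (g : SimpleFunc Plane ℂ) :
    ∫ ω, ∏ k ∈ Finset.range (N ω), g (x k ω) ∂P = Complex.exp (∫ z, (g z - 1) ∂Λ) := by
  classical
  have hmeas : ∀ c : ℂ, MeasurableSet (g ⁻¹' {c}) := fun c => SimpleFunc.measurableSet_preimage _ _
  have hind : ProbabilityTheory.iIndepFun
      (fun (c : g.range) ω => pointMeasure N x ω (g ⁻¹' {(c : ℂ)})) P := by
    have h := hΦ.indep (Fintype.card g.range)
      (fun i => g ⁻¹' {((Fintype.equivFin g.range).symm i : ℂ)}) (fun i => hmeas _) (by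
        intro i j hij
        refine Disjoint.preimage _ (Set.disjoint_singleton.2 fun h => hij ?_)
        exact (Fintype.equivFin g.range).symm.injective (Subtype.ext h))
    simpa using h.precomp (Fintype.equivFin g.range).injective
  have hfm : ∀ c : ℂ, Measurable fun v : ENNReal => c ^ ⌊v.toReal⌋₊ := fun c =>
    (measurable_from_top (f := fun n : ℕ => c ^ n)).comp
      (Nat.measurable_floor.comp ENNReal.measurable_toReal)
  have hcount : ∀ (c : ℂ) ω, c ^ pointCount N x (g ⁻¹' {c}) ω =
      c ^ ⌊(pointMeasure N x ω (g ⁻¹' {c})).toReal⌋₊ := fun c ω => by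
    rw [pointMeasure_apply N x (hmeas c)]; simp
  have hPhi : ∀ c : ℂ, Measurable fun ω => pointMeasure N x ω (g ⁻¹' {c}) := fun c =>
    (Measure.measurable_coe (hmeas c)).comp hΦ.measurable
  simp_rw [prod_points_eq_prod_pow, hcount]
  rw [hind.integral_fun_prod_comp (f := fun (c : g.range) v => (c : ℂ) ^ ⌊v.toReal⌋₊)
      (fun c => (hPhi c).aemeasurable) (fun c => (hfm c).aestronglyMeasurable),
    integral_comp_simpleFunc Λ g (fun c => c - 1), Complex.exp_sum]
  refine Finset.prod_congr rfl fun c _ => ?_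
  rw [← integral_map (f := fun v : ENNReal => (c : ℂ) ^ ⌊v.toReal⌋₊) (hPhi c).aemeasurable
      (hfm c).aestronglyMeasurable, hΦ.poisson _ (hmeas c) (measure_ne_top _ _),
    integral_map (by fun_prop) (hfm c).aestronglyMeasurable]
  simp only [ENNReal.toReal_natCast, Nat.floor_natCast]
  rw [integral_pow_poissonMeasure]
  rfl

/-- The generating functional of a Poisson point process, by approximation with simple
functions. -/
lemma IsPoissonPointProcess.integral_prod {Ω : Type*} [MeasurableSpace Ω]
    {P : Measure Ω} [IsProbabilityMeasure P] {N : Ω → ℕ} {x : ℕ → Ω → Plane}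
    (hN : Measurable N) (hx : ∀ k, Measurable (x k)) {Λ : Measure Plane} [IsFiniteMeasure Λ]
    (hΦ : IsPoissonPointProcess P (pointMeasure N x) Λ) {g : Plane → ℂ} (hg : Measurable g)
    (hg1 : ∀ z, ‖g z‖ ≤ 1) :
    ∫ ω, ∏ k ∈ Finset.range (N ω), g (x k ω) ∂P = Complex.exp (∫ z, (g z - 1) ∂Λ) := by
  have h0 : (0 : ℂ) ∈ Metric.closedBall (0 : ℂ) 1 := by simp
  set s : ℕ → SimpleFunc Plane ℂ := SimpleFunc.approxOn g hg (Metric.closedBall 0 1) 0 h0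
  have hs1 : ∀ n z, ‖s n z‖ ≤ 1 := fun n z => by
    simpa using SimpleFunc.approxOn_mem hg h0 n z
  have hlim : ∀ z, Filter.Tendsto (fun n => s n z) Filter.atTop (nhds (g z)) := fun z =>
    SimpleFunc.tendsto_approxOn hg h0 (subset_closure (by simpa using hg1 z))
  have hL : Filter.Tendsto (fun n => ∫ ω, ∏ k ∈ Finset.range (N ω), s n (x k ω) ∂P) Filter.atTop
      (nhds (∫ ω, ∏ k ∈ Finset.range (N ω), g (x k ω) ∂P)) := by
    refine tendsto_integral_of_dominated_convergence (fun _ => 1)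
      (fun n => (measurable_prod_points hN hx (s n).measurable).aestronglyMeasurable)
      (integrable_const _) (fun n => ?_) ?_
    · exact Filter.Eventually.of_forall fun ω =>
        norm_prod_points_le_one _ (fun k => x k ω) (hs1 n)
    · exact Filter.Eventually.of_forall fun ω => tendsto_finsetProd _ fun k _ => hlim _
  have hR : Filter.Tendsto (fun n => ∫ z, (s n z - 1) ∂Λ) Filter.atTop
      (nhds (∫ z, (g z - 1) ∂Λ)) := by
    refine tendsto_integral_of_dominated_convergence (fun _ => 1 + 1)
      (fun n => ((s n).measurable.sub_const 1).aestronglyMeasurable)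
      (integrable_const _) (fun n => ?_) ?_
    · exact Filter.Eventually.of_forall fun z => (norm_sub_le _ _).trans (by
        simpa using hs1 n z)
    · exact Filter.Eventually.of_forall fun z => (hlim z).sub_const 1
  refine tendsto_nhds_unique hL ?_
  simp_rw [hΦ.integral_prod_simpleFunc]
  exact (Complex.continuous_exp.tendsto _).comp hR

/-! ### Random displacement of the points -/

/-- Given the points `x k`, each point `y k` has law `κ (x k)` and the `y k` are independent; so the
generating functional of the `y k` at `g` is that of the `x k` at `z ↦ ∫ g ∂κ z`. On `N = n` this
follows by expanding both products over the level sets of `g`. -/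
lemma integral_prod_displaced {Ω : Type*} [MeasurableSpace Ω] {P : Measure Ω}
    [IsProbabilityMeasure P] {N : Ω → ℕ} {x y : ℕ → Ω → Plane}
    (hN : Measurable N) (hx : ∀ k, Measurable (x k)) (hy : ∀ k, Measurable (y k))
    (κ : ProbabilityTheory.Kernel Plane Plane) [ProbabilityTheory.IsMarkovKernel κ]
    (hκ : ∀ (n : ℕ) (B : Fin n → Set Plane), (∀ i, MeasurableSet (B i)) →
      P {ω | N ω = n ∧ ∀ i : Fin n, y i ω ∈ B i} =
        ∫⁻ ω in {ω | N ω = n}, ∏ i : Fin n, κ (x i ω) (B i) ∂P)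
    (g : SimpleFunc Plane ℂ) (hg : ∀ z, ‖g z‖ ≤ 1) :
    ∫ ω, ∏ k ∈ Finset.range (N ω), g (y k ω) ∂P =
      ∫ ω, ∏ k ∈ Finset.range (N ω), (∫ z, g z ∂κ (x k ω)) ∂P := by
  classical
  have hG1 : ∀ z, ‖∫ u, g u ∂κ z‖ ≤ 1 := fun z => by
    simpa using norm_integral_le_of_norm_le_const (μ := κ z) (Filter.Eventually.of_forall hg)
  have hGm : Measurable fun z => ∫ u, g u ∂κ z :=
    (g.stronglyMeasurable.integral_kernel (κ := κ)).measurable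
  have hint : ∀ (w : ℕ → Ω → Plane) (_ : ∀ k, Measurable (w k)) (f : Plane → ℂ)
      (_ : Measurable f) (_ : ∀ z, ‖f z‖ ≤ 1),
      Integrable (fun ω => ∏ k ∈ Finset.range (N ω), f (w k ω)) P := fun w hw f hf hf1 =>
    (integrable_const (1 : ℝ)).mono' (measurable_prod_points hN hw hf).aestronglyMeasurable
      (Filter.Eventually.of_forall fun ω => norm_prod_points_le_one _ (fun k => w k ω) hf1)
  have hS : ∀ n, MeasurableSet {ω | N ω = n} := fun n => hN (measurableSet_singleton n)
  have hU : (⋃ n, {ω | N ω = n}) = Set.univ := by ext; simp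
  have hD : Pairwise (Function.onFun Disjoint fun n => {ω | N ω = n}) := fun m n hmn =>
    Set.disjoint_left.2 fun ω h1 h2 => hmn (h1.symm.trans h2)
  rw [← setIntegral_univ, ← setIntegral_univ (μ := P) (f := fun ω => ∏ k ∈ _, ∫ z, g z ∂κ _), ← hU,
    integral_iUnion hS hD (hint y hy g g.measurable hg).integrableOn,
    integral_iUnion hS hD (hint x hx _ hGm hG1).integrableOn]
  congr 1 with n : 1
  have hpre : ∀ c : ℂ, MeasurableSet (g ⁻¹' {c}) := fun c => SimpleFunc.measurableSet_preimage _ _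
  -- the event that the `n` displaced points lie in prescribed level sets of `g`
  have hE : ∀ ℓ : Fin n → g.range,
      MeasurableSet {ω | ∀ i : Fin n, y i ω ∈ g ⁻¹' {(ℓ i : ℂ)}} := fun ℓ =>
    by
      simp only [Set.ofPred_forall]
      exact MeasurableSet.iInter fun i => hy i (hpre _)
  have hleft : ∀ ω ∈ {ω | N ω = n}, ∏ k ∈ Finset.range (N ω), g (y k ω) =
      ∑ ℓ : Fin n → g.range, {ω | ∀ i : Fin n, y i ω ∈ g ⁻¹' {(ℓ i : ℂ)}}.indicator
        (fun _ => ∏ i, (ℓ i : ℂ)) ω := by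
    intro ω hω
    rw [show N ω = n from hω, Finset.prod_range]
    rw [Finset.sum_eq_single (fun i : Fin n => ⟨g (y i ω), SimpleFunc.mem_range_self _ _⟩)]
    · simp
    · intro ℓ _ hℓ
      refine Set.indicator_of_notMem (fun h => hℓ ?_) _
      exact funext fun i => Subtype.ext (by simpa using (h i).symm)
    · simp
  have hright : ∀ ω ∈ {ω | N ω = n}, ∏ k ∈ Finset.range (N ω), (∫ z, g z ∂κ (x k ω)) =
      ∑ ℓ : Fin n → g.range,
        ((∏ i : Fin n, κ (x i ω) (g ⁻¹' {(ℓ i : ℂ)})).toReal : ℂ) * ∏ i, (ℓ i : ℂ) := by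
    intro ω hω
    rw [show N ω = n from hω, Finset.prod_range]
    simp_rw [integral_comp_simpleFunc (κ _) g (fun c => c)]
    rw [Finset.prod_univ_sum, Fintype.piFinset_univ]
    refine Finset.sum_congr rfl fun ℓ _ => ?_
    rw [Finset.prod_mul_distrib, ENNReal.toReal_prod, Complex.ofReal_prod]
    rfl
  rw [setIntegral_congr_fun (hS n) hleft, setIntegral_congr_fun (hS n) hright]
  have hpm : ∀ ℓ : Fin n → g.range,
      Measurable fun ω => ∏ i : Fin n, κ (x i ω) (g ⁻¹' {(ℓ i : ℂ)}) := fun ℓ =>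
    Finset.measurable_fun_prod _ fun i _ => (κ.measurable_coe (hpre _)).comp (hx i)
  have hp1 : ∀ (ℓ : Fin n → g.range) ω, ∏ i : Fin n, κ (x i ω) (g ⁻¹' {(ℓ i : ℂ)}) ≤ 1 :=
    fun ℓ ω => Finset.prod_le_one (fun _ _ => zero_le) fun _ _ => prob_le_one
  have hpi : ∀ ℓ : Fin n → g.range, Integrable (fun ω =>
      (∏ i : Fin n, κ (x i ω) (g ⁻¹' {(ℓ i : ℂ)})).toReal) (P.restrict {ω | N ω = n}) := fun ℓ =>
    (integrable_const (1 : ℝ)).mono' (hpm ℓ).ennreal_toReal.aestronglyMeasurable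
      (Filter.Eventually.of_forall fun ω => by
        rw [Real.norm_of_nonneg ENNReal.toReal_nonneg]
        exact ENNReal.toReal_le_of_le_ofReal zero_le_one (by simpa using hp1 ℓ ω))
  rw [integral_finsetSum _ fun ℓ _ => (integrable_const _).indicator (hE ℓ),
    integral_finsetSum _ fun ℓ _ => (hpi ℓ).ofReal.mul_const _]
  refine Finset.sum_congr rfl fun ℓ _ => ?_
  rw [integral_indicator_const _ (hE ℓ), integral_mul_const, integral_complex_ofReal,
    Complex.real_smul, integral_toReal (hpm ℓ).aemeasurable
      (Filter.Eventually.of_forall fun ω => (hp1 ℓ ω).trans_lt ENNReal.one_lt_top),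
    ← hκ n _ fun i => hpre _, Measure.real, Measure.restrict_apply (hE ℓ), Set.inter_comm]
  rfl

/-! ### Poisson processes are determined by their generating functional -/

/-- If the generating functional of the points is that of a Poisson process, then so is the joint
characteristic function of the counts of disjoint sets `A j`: it is the value of the functional at
`g = exp (i ∑ t j 1_{A j})`. -/
lemma charFun_pointCount {Ω : Type*} [MeasurableSpace Ω] {P : Measure Ω}
    {N : Ω → ℕ} {y : ℕ → Ω → Plane} {Λ : Measure Plane} [IsFiniteMeasure Λ]
    (hgen : ∀ g : SimpleFunc Plane ℂ, (∀ z, ‖g z‖ ≤ 1) →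
      ∫ ω, ∏ k ∈ Finset.range (N ω), g (y k ω) ∂P = Complex.exp (∫ z, (g z - 1) ∂Λ))
    {n : ℕ} (A : Fin n → Set Plane) (hA : ∀ i, MeasurableSet (A i))
    (hdisj : ∀ i j, i ≠ j → Disjoint (A i) (A j)) (t : Fin n → ℝ) :
    ∫ ω, Complex.exp ((∑ j, pointCount N y (A j) ω * t j : ℝ) * Complex.I) ∂P =
      ∏ j, Complex.exp (Λ.real (A j) * (Complex.exp (t j * Complex.I) - 1)) := by
  classical
  set θ : Plane → ℝ := fun z => ∑ j, (A j).indicator (fun _ => t j) z with hθ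
  have hθm : Measurable θ := Finset.measurable_fun_sum _ fun j _ =>
    measurable_const.indicator (hA j)
  have hθfin : (Set.range θ).Finite := by
    refine (Set.finite_range fun s : Fin n → Bool => ∑ j, if s j then t j else 0).subset ?_
    rintro _ ⟨z, rfl⟩
    exact ⟨fun j => decide (z ∈ A j), by simp [hθ, Set.indicator_apply]⟩
  set g : SimpleFunc Plane ℂ :=
    (⟨θ, fun c => hθm (measurableSet_singleton c), hθfin⟩ : SimpleFunc Plane ℝ).map
      fun s : ℝ => Complex.exp (s * Complex.I)
  have hgz : ∀ z, g z = Complex.exp (θ z * Complex.I) := fun z => rfl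
  have hg1 : ∀ z, ‖g z‖ ≤ 1 := fun z => by rw [hgz, Complex.norm_exp_ofReal_mul_I]
  have h1 : ∀ ω, Complex.exp ((∑ j, pointCount N y (A j) ω * t j : ℝ) * Complex.I) =
      ∏ k ∈ Finset.range (N ω), g (y k ω) := by
    intro ω
    simp_rw [hgz]
    rw [← Complex.exp_sum, ← Finset.sum_mul, ← Complex.ofReal_sum, hθ, Finset.sum_comm]
    congr 4 with j
    rw [pointCount, Nat.cast_sum, Finset.sum_mul]
    refine Finset.sum_congr rfl fun k _ => ?_
    by_cases h : y k ω ∈ A j <;> simp [h]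
  have h2 : ∀ z, g z - 1 =
      ∑ j, (A j).indicator (fun _ => Complex.exp (t j * Complex.I) - 1) z := by
    intro z
    rw [hgz]
    by_cases hz : ∃ j, z ∈ A j
    · obtain ⟨j, hj⟩ := hz
      have hne : ∀ i, i ≠ j → z ∉ A i := fun i hij hi =>
        Set.disjoint_left.1 (hdisj i j hij) hi hj
      have e : θ z = t j := by
        rw [hθ]
        simp only
        rw [Finset.sum_eq_single j (fun i _ hij => by simp [hne i hij]) (by simp)]
        simp [hj]
      rw [e, Finset.sum_eq_single j (fun i _ hij => by simp [hne i hij]) (by simp)]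
      simp [hj]
    · push Not at hz
      simp [hθ, hz]
  simp_rw [h1]
  rw [hgen g hg1, ← Complex.exp_sum]
  simp_rw [h2]
  rw [integral_finsetSum _ fun j _ => (integrable_const _).indicator (hA j)]
  congr 1
  refine Finset.sum_congr rfl fun j _ => ?_
  rw [integral_indicator_const _ (hA j), Complex.real_smul]

/-- A random finite point configuration with the generating functional of a Poisson process is a
Poisson process, because characteristic functions determine the joint law of the counts. -/
lemma isPoissonPointProcess_of_integral_prod {Ω : Type*} [MeasurableSpace Ω] {P : Measure Ω}
    [IsProbabilityMeasure P] {N : Ω → ℕ} {y : ℕ → Ω → Plane} (hN : Measurable N)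
    (hy : ∀ k, Measurable (y k)) {Λ : Measure Plane} [IsFiniteMeasure Λ]
    (hgen : ∀ g : SimpleFunc Plane ℂ, (∀ z, ‖g z‖ ≤ 1) →
      ∫ ω, ∏ k ∈ Finset.range (N ω), g (y k ω) ∂P = Complex.exp (∫ z, (g z - 1) ∂Λ)) :
    IsPoissonPointProcess P (pointMeasure N y) Λ := by
  have hcm : ∀ A, MeasurableSet A → Measurable fun ω => (pointCount N y A ω : ℝ) := fun A hA =>
    (measurable_from_top (f := fun n : ℕ => (n : ℝ))).comp (measurable_pointCount hN hy hA)
  have hlaw : ∀ A, MeasurableSet A → P.map (fun ω => (pointCount N y A ω : ℝ)) =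
      (ProbabilityTheory.poissonMeasure (Λ A).toNNReal).map (fun n : ℕ => (n : ℝ)) := by
    intro A hA
    have : IsProbabilityMeasure (P.map fun ω => (pointCount N y A ω : ℝ)) :=
      Measure.isProbabilityMeasure_map (hcm A hA).aemeasurable
    refine Measure.ext_of_charFun (funext fun t => ?_)
    rw [ProbabilityTheory.charFun_map_cast_poissonMeasure, charFun_apply,
      integral_map (hcm A hA).aemeasurable (by fun_prop)]
    have h := charFun_pointCount hgen (n := 1) (fun _ => A) (fun _ => hA)
      (fun i j hij => absurd (Subsingleton.elim i j) hij) (fun _ => t)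
    simp only [Finset.univ_unique, Finset.sum_singleton, Finset.prod_singleton] at h
    simp_rw [Real.inner_apply]
    rw [h]
    rfl
  have hback : ∀ A, MeasurableSet A → (fun ω => pointMeasure N y ω A) =
      ENNReal.ofReal ∘ fun ω => (pointCount N y A ω : ℝ) := fun A hA => by
    ext ω
    simp [pointMeasure_apply N y hA]
  refine ⟨measurable_pointMeasure hN hy, ?_, ?_, ?_, ?_⟩
  · refine Filter.Eventually.of_forall fun ω =>
      ⟨(Finset.range (N ω) : Finset ℕ), fun k => y k ω, ?_⟩
    rw [pointMeasure, Measure.sum_fintype]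
    exact (Finset.sum_coe_sort (Finset.range (N ω)) fun k => Measure.dirac (y k ω)).symm
  · refine Filter.Eventually.of_forall fun ω => ?_
    have : IsFiniteMeasure (pointMeasure N y ω) :=
      ⟨by rw [pointMeasure_apply N y MeasurableSet.univ]; exact ENNReal.natCast_lt_top _⟩
    infer_instance
  · intro A hA _
    rw [hback A hA, ← Measure.map_map ENNReal.measurable_ofReal (hcm A hA), hlaw A hA,
      Measure.map_map ENNReal.measurable_ofReal (by fun_prop)]
    congr 1 with n
    simp
  · intro n A hA hdisj
    have hind : ProbabilityTheory.iIndepFun (fun i ω => (pointCount N y (A i) ω : ℝ)) P := by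
      rw [ProbabilityTheory.iIndepFun_iff_charFun_pi fun i => (hcm _ (hA i)).aemeasurable]
      intro t
      rw [charFun_apply, integral_map (by
        exact ((WithLp.measurable_toLp 2 _).comp
          (measurable_pi_lambda _ fun i => hcm _ (hA i))).aemeasurable) (by fun_prop)]
      have hlaw' := fun i => hlaw _ (hA i)
      simp_rw [hlaw', ProbabilityTheory.charFun_map_cast_poissonMeasure]
      have h := charFun_pointCount hgen A hA hdisj t
      simp_rw [PiLp.inner_apply, Real.inner_apply]
      exact h
    rw [show (fun i ω => pointMeasure N y ω (A i)) = fun i => ENNReal.ofReal ∘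
      fun ω => (pointCount N y (A i) ω : ℝ) from funext fun i => hback _ (hA i)]
    exact hind.comp (fun _ => ENNReal.ofReal) fun _ => ENNReal.measurable_ofReal

/-! ### The displacement theorem -/

/-- The exponent `∫ (g - 1)` of the generating functional, before and after displacement. -/
lemma integral_integral_sub_one (κ : ProbabilityTheory.Kernel Plane Plane)
    [ProbabilityTheory.IsMarkovKernel κ] (Λ : Measure Plane) [IsFiniteMeasure Λ]
    (g : SimpleFunc Plane ℂ) :
    ∫ z, ((∫ u, g u ∂κ z) - 1) ∂Λ = ∫ u, (g u - 1) ∂(Λ.bind κ) := by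
  have hpre : ∀ c : ℂ, MeasurableSet (g ⁻¹' {c}) := fun c => SimpleFunc.measurableSet_preimage _ _
  have hgi : ∀ μ : Measure Plane, IsFiniteMeasure μ → Integrable g μ := fun μ _ =>
    SimpleFunc.integrable_of_isFiniteMeasure g
  have h1 : ∀ z, (∫ u, g u ∂κ z) - 1 =
      ∑ c : g.range, (κ z).real (g ⁻¹' {(c : ℂ)}) * ((c : ℂ) - 1) := by
    intro z
    rw [← integral_comp_simpleFunc (κ z) g (fun c => c - 1),
      integral_sub (hgi _ inferInstance) (integrable_const _)]
    simp
  simp_rw [h1]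
  have hm : ∀ c : ℂ, Measurable fun z => κ z (g ⁻¹' {c}) := fun c => κ.measurable_coe (hpre c)
  have hi : ∀ c : ℂ, Integrable (fun z => (κ z).real (g ⁻¹' {c})) Λ := fun c =>
    (integrable_const (1 : ℝ)).mono' (hm c).ennreal_toReal.aestronglyMeasurable
      (Filter.Eventually.of_forall fun z => by
        rw [Real.norm_of_nonneg measureReal_nonneg]
        exact measureReal_le_one)
  have hiC : ∀ c : g.range, Integrable
      (fun z => ((κ z).real (g ⁻¹' {(c : ℂ)}) : ℂ) * ((c : ℂ) - 1)) Λ := fun c =>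
    (hi c).ofReal.mul_const _
  rw [integral_finsetSum _ fun c _ => hiC c,
    integral_comp_simpleFunc (Λ.bind κ) g (fun c => c - 1)]
  refine Finset.sum_congr rfl fun c _ => ?_
  rw [integral_mul_const, integral_complex_ofReal, Measure.real,
    Measure.bind_apply (hpre c) κ.aemeasurable]
  congr 2
  exact integral_toReal (hm c).aemeasurable
    (Filter.Eventually.of_forall fun z => measure_lt_top _ _)

/-- The displacement theorem: if the points of a Poisson process of finite intensity `Λ` are moved
independently, a point at `z` according to `κ z`, the result is a Poisson process of intensity
`∫ κ z ∂Λ`. -/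
theorem IsPoissonPointProcess.displacement {Ω : Type*} [MeasurableSpace Ω] {P : Measure Ω}
    [IsProbabilityMeasure P] {N : Ω → ℕ} {x y : ℕ → Ω → Plane}
    (hN : Measurable N) (hx : ∀ k, Measurable (x k)) (hy : ∀ k, Measurable (y k))
    {Λ : Measure Plane} [IsFiniteMeasure Λ]
    (hΦ : IsPoissonPointProcess P (pointMeasure N x) Λ)
    (κ : ProbabilityTheory.Kernel Plane Plane) [ProbabilityTheory.IsMarkovKernel κ]
    (hκ : ∀ (n : ℕ) (B : Fin n → Set Plane), (∀ i, MeasurableSet (B i)) →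
      P {ω | N ω = n ∧ ∀ i : Fin n, y i ω ∈ B i} =
        ∫⁻ ω in {ω | N ω = n}, ∏ i : Fin n, κ (x i ω) (B i) ∂P) :
    IsPoissonPointProcess P (pointMeasure N y) (Λ.bind κ) := by
  refine isPoissonPointProcess_of_integral_prod hN hy fun g hg => ?_
  rw [integral_prod_displaced hN hx hy κ hκ g hg,
    hΦ.integral_prod hN hx (g := fun z => ∫ u, g u ∂κ z)
      (g.stronglyMeasurable.integral_kernel (κ := κ)).measurable (fun z => by
        simpa using norm_integral_le_of_norm_le_const (μ := κ z) (Filter.Eventually.of_forall hg)),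
    integral_integral_sub_one]

/-! ### The intensity of the receivers -/

lemma volume_closedBall_plane (c : Plane) {r : ℝ} (hr : 0 ≤ r) :
    volume (Metric.closedBall c r) = ENNReal.ofReal (Real.pi * r ^ 2) := by
  rw [EuclideanSpace.volume_closedBall_fin_two, ← ENNReal.ofReal_pow hr,
    ← ENNReal.ofReal_mul (by positivity), mul_comm]

lemma uniformDisk_apply (c : Plane) {r : ℝ} (hr : 0 < r) (B : Set Plane) :
    uniformDisk c r B =
      (ENNReal.ofReal (Real.pi * r ^ 2))⁻¹ * volume (Metric.closedBall c r ∩ B) := by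
  rw [uniformDisk, ProbabilityTheory.cond_apply Metric.isClosed_closedBall.measurableSet,
    volume_closedBall_plane c hr.le]

lemma measurableSet_dist_le (r : ℝ) : MeasurableSet {p : Plane × Plane | dist p.2 p.1 ≤ r} :=
  (isClosed_le (by fun_prop) continuous_const).measurableSet

/-- The uniform distribution on the disk of radius `r`, as a kernel in the centre of the disk. -/
noncomputable def uniformDiskKernel {r : ℝ} (hr : 0 < r) :
    ProbabilityTheory.Kernel Plane Plane where
  toFun c := uniformDisk c r
  measurable' := by
    refine Measure.measurable_of_measurable_coe _ fun B hB => ?_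
    simp_rw [uniformDisk_apply _ hr]
    exact (measurable_measure_prodMk_left
      ((measurableSet_dist_le r).inter (measurable_snd hB))).const_mul _

instance {r : ℝ} (hr : 0 < r) : ProbabilityTheory.IsMarkovKernel (uniformDiskKernel hr) :=
  ⟨fun _ => ProbabilityTheory.cond_isProbabilityMeasure_of_finite
    (Metric.measure_closedBall_pos _ _ hr).ne' measure_closedBall_lt_top.ne⟩

/-- By rotation invariance, the overlap of two disks depends only on the distance of the centres. -/
lemma volume_inter_closedBall (z : Plane) (R r : ℝ) :
    volume (Metric.closedBall (0 : Plane) R ∩ Metric.closedBall z r) =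
      ENNReal.ofReal (overlapArea ‖z‖ R r) := by
  have hw : ‖z‖ = ‖(!₂[‖z‖, 0] : Plane)‖ := by
    simp [EuclideanSpace.norm_eq, Fin.sum_univ_two]
  have hL := Submodule.reflection_sub hw
  set L := (ℝ ∙ (z - (!₂[‖z‖, 0] : Plane)))ᗮ.reflection
  have hpre : L ⁻¹' (Metric.closedBall 0 R ∩ Metric.closedBall (!₂[‖z‖, 0] : Plane) r) =
      Metric.closedBall (0 : Plane) R ∩ Metric.closedBall z r := by
    ext p
    simp only [Set.mem_preimage, Set.mem_inter_iff, Metric.mem_closedBall]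
    rw [← hL, L.dist_map, dist_zero_right, dist_zero_right, L.norm_map]
  rw [overlapArea, Measure.real, ENNReal.ofReal_toReal
    ((measure_mono Set.inter_subset_left).trans_lt measure_closedBall_lt_top).ne, ← hpre]
  exact L.measurePreserving.measure_preimage (Metric.isClosed_closedBall.measurableSet.inter
    Metric.isClosed_closedBall.measurableSet).nullMeasurableSet

lemma norm_axis_point {d : ℝ} (hd : 0 ≤ d) : ‖(!₂[d, 0] : Plane)‖ = d := by
  simp [EuclideanSpace.norm_eq, Fin.sum_univ_two, Real.sqrt_sq hd]

/-- The three cases of the density are one formula, because the overlap is the whole small disk for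
`d < R - r` and empty for `R + r < d`. -/
lemma receiverDensity_eq {lam R r d : ℝ} (hr : 0 < r) (hd : 0 ≤ d) :
    receiverDensity lam R r d = lam * (overlapArea d R r / (Real.pi * r ^ 2)) := by
  unfold receiverDensity
  split_ifs with h1 h2
  · have : Metric.closedBall (!₂[d, 0] : Plane) r ⊆ Metric.closedBall 0 R :=
      Metric.closedBall_subset_closedBall' (by
        rw [dist_zero_right, norm_axis_point hd]; linarith)
    rw [overlapArea, Set.inter_eq_right.2 this, Measure.real, volume_closedBall_plane _ hr.le,
      ENNReal.toReal_ofReal (by positivity), div_self (by positivity), mul_one]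
  · rfl
  · have : Disjoint (Metric.closedBall 0 R) (Metric.closedBall (!₂[d, 0] : Plane) r) :=
      Metric.closedBall_disjoint_closedBall (by
        rw [dist_zero_left, norm_axis_point hd]; linarith)
    rw [overlapArea, this.inter_eq, Measure.real]
    simp

/-- Mixing the uniform distributions on the disks of radius `r` over centres in the disk of radius
`R`: by Fubini's theorem the density at `z` is proportional to the area of the set of centres in
reach of `z`. -/
lemma bind_uniformDiskKernel {lam R r : ℝ} (hlam : 0 ≤ lam) (hr : 0 < r) :
    (ENNReal.ofReal lam • volume.restrict (Metric.closedBall (0 : Plane) R)).bind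
        (uniformDiskKernel hr) =
      volume.withDensity (fun z : Plane => ENNReal.ofReal (receiverDensity lam R r ‖z‖)) := by
  ext B hB
  have hfub : ∫⁻ c in Metric.closedBall (0 : Plane) R, volume (Metric.closedBall c r ∩ B) =
      ∫⁻ z in B, volume (Metric.closedBall (0 : Plane) R ∩ Metric.closedBall z r) := by
    have hS := measurableSet_dist_le r
    have h1 := Measure.prod_apply (μ := volume.restrict (Metric.closedBall (0 : Plane) R))
      (ν := volume.restrict B) hS
    rw [Measure.prod_apply_symm hS] at h1
    convert! h1.symm using 1
    · refine lintegral_congr fun c => ?_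
      rw [Measure.restrict_apply (measurable_prodMk_left hS)]
      rfl
    · refine lintegral_congr fun z => ?_
      rw [Measure.restrict_apply (measurable_prodMk_right hS), Set.inter_comm]
      congr 2
      ext c
      simp [dist_comm]
  rw [Measure.bind_apply hB (uniformDiskKernel hr).aemeasurable, withDensity_apply _ hB,
    lintegral_smul_measure]
  change _ • ∫⁻ c in _, uniformDisk c r B = _
  have hV : ENNReal.ofReal (Real.pi * r ^ 2) ≠ 0 := by
    rw [Ne, ENNReal.ofReal_eq_zero, not_le]; positivity
  simp_rw [uniformDisk_apply _ hr]
  rw [lintegral_const_mul' _ _ (ENNReal.inv_ne_top.2 hV), hfub, smul_eq_mul, ← mul_assoc,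
    ← lintegral_const_mul' _ _ (ENNReal.mul_ne_top ENNReal.ofReal_ne_top (ENNReal.inv_ne_top.2 hV))]
  refine lintegral_congr fun z => ?_
  rw [receiverDensity_eq hr (norm_nonneg _), volume_inter_closedBall,
    ← ENNReal.ofReal_inv_of_pos (by positivity), ← ENNReal.ofReal_mul hlam,
    ← ENNReal.ofReal_mul (by positivity)]
  congr 1
  ring

/-! ### The area of the lens -/

lemma integral_two_mul_sqrt_sub_sq {R a : ℝ} (hR : 0 < R) (ha : -R ≤ a) (haR : a ≤ R) :
    ∫ x in a..R, 2 * Real.sqrt (R ^ 2 - x ^ 2) =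
      R ^ 2 * Real.arccos (a / R) - a * Real.sqrt (R ^ 2 - a ^ 2) := by
  rw [intervalIntegral.integral_eq_sub_of_hasDerivAt_of_le
    (f := fun x => x * Real.sqrt (R ^ 2 - x ^ 2) - R ^ 2 * Real.arccos (x / R)) haR]
  · simp [hR.ne']
  · exact (Continuous.continuousOn (by fun_prop))
  · intro x hx
    have h1 : 0 < R ^ 2 - x ^ 2 := by nlinarith [hx.1, hx.2]
    have hs : 0 < Real.sqrt (R ^ 2 - x ^ 2) := Real.sqrt_pos.2 h1
    have hss := Real.sq_sqrt h1.le
    have hlt : x / R < 1 := (div_lt_one hR).2 hx.2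
    have hgt : -1 < x / R := by rw [lt_div_iff₀ hR]; linarith [hx.1]
    have hroot : Real.sqrt (1 - (x / R) ^ 2) = Real.sqrt (R ^ 2 - x ^ 2) / R := by
      rw [show 1 - (x / R) ^ 2 = (R ^ 2 - x ^ 2) / R ^ 2 by field_simp,
        Real.sqrt_div h1.le, Real.sqrt_sq hR.le]
    have hd1 : HasDerivAt (fun x : ℝ => R ^ 2 - x ^ 2) (-(2 * x)) x := by
      simpa using ((hasDerivAt_id x).pow 2).const_sub (R ^ 2)
    have hd2 := (hasDerivAt_id x).mul (hd1.sqrt h1.ne')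
    have hd3 := (((Real.hasDerivAt_arccos hgt.ne' hlt.ne).comp x
      ((hasDerivAt_id x).div_const R)).const_mul (R ^ 2))
    convert! hd2.sub hd3 using 1
    simp only [id]
    rw [hroot]
    field_simp
    rw [hss]
    ring
  · exact (Continuous.intervalIntegrable (by fun_prop) _ _)

/-- The area of a disk segment, cut off by a vertical line at `a`; whether the line itself belongs
to the segment (`s = Ici a` or `s = Ioi a`) does not matter. -/
lemma volume_disk_segment {R a : ℝ} (hR : 0 < R) (ha : -R ≤ a) (haR : a ≤ R) {s : Set ℝ}
    (hs : MeasurableSet s) (hsa : s =ᵐ[volume] Set.Ioi a) :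
    volume ({p : Plane | p 0 ∈ s} ∩ Metric.closedBall 0 R) =
      ENNReal.ofReal (R ^ 2 * Real.arccos (a / R) - a * Real.sqrt (R ^ 2 - a ^ 2)) := by
  set T : Set (ℝ × ℝ) := {q | q.1 ∈ s ∧ q.1 ^ 2 + q.2 ^ 2 ≤ R ^ 2} with hT
  have hTm : MeasurableSet T := (measurable_fst hs).inter
    (isClosed_le (f := fun q : ℝ × ℝ => q.1 ^ 2 + q.2 ^ 2) (by fun_prop)
      continuous_const).measurableSet
  have hmp := (volume_preserving_finTwoArrow ℝ).comp
    (EuclideanSpace.volume_preserving_symm_measurableEquiv_toLp (Fin 2))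
  have hpre : {p : Plane | p 0 ∈ s} ∩ Metric.closedBall 0 R =
      (MeasurableEquiv.finTwoArrow ∘ (MeasurableEquiv.toLp 2 (Fin 2 → ℝ)).symm) ⁻¹' T := by
    ext p
    simp [hT, EuclideanSpace.norm_eq, Fin.sum_univ_two, Real.sqrt_le_left hR.le]
  rw [hpre, hmp.measure_preimage hTm.nullMeasurableSet, Measure.volume_eq_prod,
    Measure.prod_apply hTm]
  have hslice : ∀ x : ℝ, volume (Prod.mk x ⁻¹' T) =
      s.indicator (fun x => ENNReal.ofReal (2 * Real.sqrt (R ^ 2 - x ^ 2))) x := by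
    intro x
    by_cases hx : x ∈ s
    · rw [Set.indicator_of_mem hx]
      rcases le_or_gt 0 (R ^ 2 - x ^ 2) with h | h
      · have : Prod.mk x ⁻¹' T =
            Set.Icc (-Real.sqrt (R ^ 2 - x ^ 2)) (Real.sqrt (R ^ 2 - x ^ 2)) := by
          ext y
          simp only [hT, Set.mem_preimage, Set.mem_ofPred_eq, hx, true_and, Set.mem_Icc]
          rw [← abs_le, ← Real.sqrt_sq_eq_abs, Real.sqrt_le_sqrt_iff h]
          constructor <;> intro h' <;> linarith
        rw [this, Real.volume_Icc]
        congr 1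
        ring
      · have : Prod.mk x ⁻¹' T = ∅ := by
          ext y
          simp only [hT, Set.mem_preimage, Set.mem_ofPred_eq, Set.mem_empty_iff_false, iff_false]
          intro h'
          nlinarith [h'.2, sq_nonneg y]
        rw [this, Real.sqrt_eq_zero_of_nonpos h.le]
        simp
    · rw [Set.indicator_of_notMem hx]
      have : Prod.mk x ⁻¹' T = ∅ := by
        ext y
        simp [hT, hx]
      rw [this, measure_empty]
  simp_rw [hslice]
  have hzero : ∀ x ∈ Set.Ioi R, ENNReal.ofReal (2 * Real.sqrt (R ^ 2 - x ^ 2)) = 0 := by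
    intro x hx
    rw [Real.sqrt_eq_zero_of_nonpos (by nlinarith [Set.mem_Ioi.1 hx])]
    simp
  rw [lintegral_indicator hs, setLIntegral_congr hsa, ← Set.Ioc_union_Ioi_eq_Ioi haR,
    lintegral_union measurableSet_Ioi (Set.Ioc_disjoint_Ioi le_rfl),
    setLIntegral_congr_fun measurableSet_Ioi hzero, lintegral_zero, add_zero,
    ← ofReal_integral_eq_lintegral_ofReal, ← intervalIntegral.integral_of_le haR,
    integral_two_mul_sqrt_sub_sq hR ha haR]
  · exact (Continuous.integrableOn_Ioc (by fun_prop))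
  · exact Filter.Eventually.of_forall fun x => by positivity

/-- The radical line of the two circles, at abscissa `a`, cuts the lens into a segment of each
disk. -/
lemma overlapArea_eq_lensFormula {d R r : ℝ} (hR : 0 < R) (hr : 0 < r) (hd : 0 < d)
    (h1 : |R - r| ≤ d) (h2 : d ≤ R + r) : overlapArea d R r = lensFormula d R r := by
  obtain ⟨h1a, h1b⟩ := abs_le.1 h1
  set a : ℝ := (d ^ 2 + R ^ 2 - r ^ 2) / (2 * d) with ha
  have had : 2 * d * a = d ^ 2 + R ^ 2 - r ^ 2 := by rw [ha]; field_simp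
  have hb : d - a = (d ^ 2 + r ^ 2 - R ^ 2) / (2 * d) := by rw [ha]; field_simp; ring
  have haR : a ≤ R := by
    rw [ha, div_le_iff₀ (by positivity)]; nlinarith
  have haR' : -R ≤ a := by
    rw [ha, le_div_iff₀ (by positivity)]; nlinarith
  have hbr : d - a ≤ r := by
    rw [hb, div_le_iff₀ (by positivity)]; nlinarith
  have hbr' : -r ≤ d - a := by
    rw [hb, le_div_iff₀ (by positivity)]; nlinarith
  set w : Plane := !₂[d, 0] with hw
  have hball : ∀ (p : Plane) {ρ : ℝ}, 0 < ρ →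
      (p ∈ Metric.closedBall 0 ρ ↔ p 0 ^ 2 + p 1 ^ 2 ≤ ρ ^ 2) := fun p ρ hρ => by
    simp [EuclideanSpace.norm_eq, Fin.sum_univ_two, Real.sqrt_le_left hρ.le]
  have hballw : ∀ (p : Plane),
      (p ∈ Metric.closedBall w r ↔ (p 0 - d) ^ 2 + p 1 ^ 2 ≤ r ^ 2) := fun p => by
    simp [EuclideanSpace.dist_eq, Fin.sum_univ_two, Real.sqrt_le_left hr.le, hw,
      Real.dist_eq, sq_abs]
  have h0 : Continuous fun p : Plane => p 0 := by fun_prop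
  have hH : MeasurableSet {p : Plane | p 0 ∈ Set.Ioi a} := by
    exact (isOpen_lt continuous_const h0).measurableSet
  have hright : (Metric.closedBall 0 R ∩ Metric.closedBall w r) ∩ {p : Plane | p 0 ∈ Set.Ioi a} =
      {p : Plane | p 0 ∈ Set.Ioi a} ∩ Metric.closedBall 0 R := by
    ext p
    simp only [Set.mem_inter_iff, hball p hR, hballw, Set.mem_ofPred_eq, Set.mem_Ioi]
    constructor
    · rintro ⟨⟨h, -⟩, h'⟩
      exact ⟨h', h⟩
    · rintro ⟨h', h⟩
      refine ⟨⟨h, ?_⟩, h'⟩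
      nlinarith [mul_lt_mul_of_pos_left h' hd]
  have hleft : (Metric.closedBall 0 R ∩ Metric.closedBall w r) \ {p : Plane | p 0 ∈ Set.Ioi a} =
      (fun p => w - p) ⁻¹' ({p : Plane | p 0 ∈ Set.Ici (d - a)} ∩ Metric.closedBall 0 r) := by
    ext p
    simp only [Set.mem_inter_iff, Set.mem_sdiff, hball _ hR, hballw, Set.mem_ofPred_eq, Set.mem_Ioi,
      Set.mem_preimage, hball _ hr, Set.mem_Ici, not_lt]
    have e0 : (w - p) 0 = d - p 0 := by simp [hw]
    have e1 : (w - p) 1 = - p 1 := by simp [hw]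
    rw [e0, e1]
    constructor
    · rintro ⟨⟨-, h⟩, h'⟩
      exact ⟨by linarith, by nlinarith⟩
    · rintro ⟨h', h⟩
      have h'' : p 0 ≤ a := by linarith
      exact ⟨⟨by nlinarith [mul_le_mul_of_nonneg_left h'' hd.le], by nlinarith⟩, h''⟩
  have hv1 := volume_disk_segment hR haR' haR measurableSet_Ioi (Filter.EventuallyEq.refl _ _)
  have hv2 := volume_disk_segment hr hbr' hbr measurableSet_Ici Ioi_ae_eq_Ici.symm
  have hm2 : MeasurableSet ({p : Plane | p 0 ∈ Set.Ici (d - a)} ∩ Metric.closedBall 0 r) :=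
    (show IsClosed {p : Plane | p 0 ∈ Set.Ici (d - a)} from
      isClosed_le continuous_const h0).measurableSet.inter
      Metric.isClosed_closedBall.measurableSet
  have hsub : MeasurePreserving (fun p : Plane => w - p) volume volume :=
    Measure.measurePreserving_sub_left volume w
  -- both segments have the common chord of the two circles as their chord
  have hchord : Real.sqrt (r ^ 2 - (d - a) ^ 2) = Real.sqrt (R ^ 2 - a ^ 2) := by
    congr 1; linarith
  have hroot : Real.sqrt (2 * r ^ 2 * (R ^ 2 + d ^ 2) - r ^ 4 - (R ^ 2 - d ^ 2) ^ 2) =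
      2 * d * Real.sqrt (R ^ 2 - a ^ 2) := by
    rw [show 2 * r ^ 2 * (R ^ 2 + d ^ 2) - r ^ 4 - (R ^ 2 - d ^ 2) ^ 2 =
        (2 * d) ^ 2 * (R ^ 2 - a ^ 2) by
      have : (2 * d) ^ 2 * (R ^ 2 - a ^ 2) = 4 * d ^ 2 * R ^ 2 - (2 * d * a) ^ 2 := by ring
      rw [this, had]; ring, Real.sqrt_mul (by positivity), Real.sqrt_sq (by positivity)]
  have hargR : (d ^ 2 + R ^ 2 - r ^ 2) / (2 * d * R) = a / R := by rw [ha, div_div]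
  have hargr : (d ^ 2 + r ^ 2 - R ^ 2) / (2 * d * r) = (d - a) / r := by rw [hb, div_div]
  have hnn : ∀ {ρ b : ℝ}, 0 < ρ → -ρ ≤ b → b ≤ ρ →
      0 ≤ ρ ^ 2 * Real.arccos (b / ρ) - b * Real.sqrt (ρ ^ 2 - b ^ 2) := fun hρ hb hb' => by
    rw [← integral_two_mul_sqrt_sub_sq hρ hb hb']
    exact intervalIntegral.integral_nonneg hb' fun x _ => by positivity
  rw [overlapArea, Measure.real, ← measure_inter_add_sdiff _ hH, hright, hleft,
    hsub.measure_preimage hm2.nullMeasurableSet, hv1, hv2,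
    ENNReal.toReal_add ENNReal.ofReal_ne_top ENNReal.ofReal_ne_top,
    ENNReal.toReal_ofReal (hnn hR haR' haR), ENNReal.toReal_ofReal (hnn hr hbr' hbr),
    lensFormula, hroot, hchord, hargR, hargr]
  ring

theorem proposition4 {Ω : Type*} [MeasurableSpace Ω] (P : Measure Ω) [IsProbabilityMeasure P]
    (lam R RD : ℝ) (hlam : 0 ≤ lam) (hR : 0 < R) (hRD : 0 < RD)
    (N : Ω → ℕ) (x y : ℕ → Ω → Plane)
    (hN : Measurable N) (hx : ∀ k, Measurable (x k)) (hy : ∀ k, Measurable (y k))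
    (hΦ : IsPoissonPointProcess P (pointMeasure N x)
      (ENNReal.ofReal lam • volume.restrict (Metric.closedBall (0 : Plane) R)))
    (hunif : HasUniformReceivers P N x y RD) :
    IsPoissonPointProcess P (pointMeasure N y)
        (volume.withDensity (fun z : Plane => ENNReal.ofReal (receiverDensity lam R RD ‖z‖))) ∧
      ∀ d : ℝ, 0 < d → |R - RD| ≤ d → d ≤ R + RD →
        overlapArea d R RD = lensFormula d R RD := by
  refine ⟨?_, fun d hd h1 h2 => overlapArea_eq_lensFormula hR hRD hd h1 h2⟩
  have : IsFiniteMeasure (volume.restrict (Metric.closedBall (0 : Plane) R)) :=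
    isFiniteMeasure_restrict.2 measure_closedBall_lt_top.ne
  have : IsFiniteMeasure
      (ENNReal.ofReal lam • volume.restrict (Metric.closedBall (0 : Plane) R)) :=
    Measure.smul_finite _ ENNReal.ofReal_ne_top
  rw [← bind_uniformDiskKernel hlam hRD]
  refine hΦ.displacement hN hx hy (uniformDiskKernel hRD) fun n B hB => ?_
  simpa using! hunif n Set.univ B MeasurableSet.univ hB
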